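/- Let $d,k\in\mathbb{N}$ with $k\geq 3$. There is a constant $C=C(d,k)>0$, depending only on $d$ and $k$, such that for every finite simple graph $\Gamma$ (with $|\Gamma|$ vertices) of maximal degree at most $d$ there is a $1$-thick topological embedding $f:\Gamma\to\mathbb{R}^k$ with $$\operatorname{diam}(f)\leq C\,|\Gamma|^{1/(k-1)}\qquad\text{and}\qquad \operatorname{vol}(f)\leq C\,|\Gamma|^{1+1/(k-1)}.$$ Here $\Gamma$ also denotes the topological realisation of the graph (its vertices together with one unit interval for each edge, the two ends of which are glued to the two end vertices of the edge), and $\mathbb{R}^k$ carries the Euclidean metric and Lebesgue measure. A topological embedding $f:\Gamma\to\mathbb{R}^k$ is a homeomorphism onto its image. It is $1$-thick if $\|f(x)-f(y)\|\geq 1$ whenever $x,y$ are two distinct vertices; or $x$ is a point of a closed edge and $y$ is a vertex not contained in that edge; or $x$ and $y$ are points of two closed edges with no common end vertex. Finally $\operatorname{diam}(f)$ is the diameter of the image of $f$, and $\operatorname{vol}(f)$ is the Lebesgue measure of the open $1$-neighbourhood of the image of $f$. -/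

import Mathlib

/-- The disjoint union of the vertex set of `G` and of one unit interval for every dart (edge with
an orientation) of `G`. -/
def GraphPreRealisation {V : Type*} (G : SimpleGraph V) : Type _ :=
  V ⊕ (Σ _ : G.Dart, unitInterval)

/-- The disjoint union topology; the vertex set is discrete. -/
instance {V : Type*} (G : SimpleGraph V) : TopologicalSpace (GraphPreRealisation G) :=
  letI : TopologicalSpace V := ⊥
  inferInstanceAs (TopologicalSpace (V ⊕ (Σ _ : G.Dart, unitInterval)))

/-- The gluing: the ends of the interval of a dart are identified with the vertices that label
them, and the intervals of the two orientations of one edge are identified by `t ↦ 1 - t`, so that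
each edge contributes exactly one interval. -/
inductive GraphGlue {V : Type*} (G : SimpleGraph V) :
    GraphPreRealisation G → GraphPreRealisation G → Prop
  | fst (a : G.Dart) : GraphGlue G (Sum.inr ⟨a, 0⟩) (Sum.inl a.fst)
  | snd (a : G.Dart) : GraphGlue G (Sum.inr ⟨a, 1⟩) (Sum.inl a.snd)
  | symm (a : G.Dart) (t : unitInterval) :
      GraphGlue G (Sum.inr ⟨a, t⟩) (Sum.inr ⟨a.symm, unitInterval.symm t⟩)

/-- The topological realisation of a graph. -/
def GraphRealisation {V : Type*} (G : SimpleGraph V) : Type _ :=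
  Quot (GraphGlue G)

/-- The quotient topology. -/
instance {V : Type*} (G : SimpleGraph V) : TopologicalSpace (GraphRealisation G) :=
  inferInstanceAs (TopologicalSpace (Quot (GraphGlue G)))

/-- The point of the realisation given by a vertex. -/
def GraphRealisation.vertex {V : Type*} (G : SimpleGraph V) (v : V) : GraphRealisation G :=
  Quot.mk (GraphGlue G) (Sum.inl v)

/-- The point with parameter `t` on the edge underlying the dart `a`, running from `a.fst` at
`t = 0` to `a.snd` at `t = 1`. -/
def GraphRealisation.point {V : Type*} (G : SimpleGraph V) (a : G.Dart) (t : unitInterval) :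
    GraphRealisation G :=
  Quot.mk (GraphGlue G) (Sum.inr ⟨a, t⟩)

/-- The closed edge (end points included) of the realisation given by an edge `e`. -/
def GraphRealisation.edge {V : Type*} (G : SimpleGraph V) (e : G.edgeSet) :
    Set (GraphRealisation G) :=
  {x | ∃ (a : G.Dart) (t : unitInterval), a.edge = (e : Sym2 V) ∧ x = GraphRealisation.point G a t}

/-- `g` is an `ε`-thick topological embedding of the graph `G` into the metric space `Z`. -/
structure IsThickEmbedding {V : Type*} (G : SimpleGraph V) {Z : Type*} [MetricSpace Z] (ε : ℝ)
    (g : GraphRealisation G → Z) : Prop where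
  isEmbedding : Topology.IsEmbedding g
  vertex_vertex : ∀ v w : V, v ≠ w →
    ε ≤ dist (g (GraphRealisation.vertex G v)) (g (GraphRealisation.vertex G w))
  edge_vertex : ∀ (e : G.edgeSet) (v : V), v ∉ (e : Sym2 V) →
    ∀ x ∈ GraphRealisation.edge G e, ε ≤ dist (g x) (g (GraphRealisation.vertex G v))
  edge_edge : ∀ e e' : G.edgeSet, (∀ v : V, v ∈ (e : Sym2 V) → v ∉ (e' : Sym2 V)) →
    ∀ x ∈ GraphRealisation.edge G e, ∀ y ∈ GraphRealisation.edge G e', ε ≤ dist (g x) (g y)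

/-- The diameter of a map: the diameter of its image, with values in `[0, ∞]`. -/
noncomputable def mapDiam {X Z : Type*} [MetricSpace Z] (g : X → Z) : ENNReal :=
  Metric.ediam (Set.range g)

/-- The volume of a map: the measure of the `1`-neighbourhood of its image, with values in
`[0, ∞]`. -/
noncomputable def mapVol {X Z : Type*} [MetricSpace Z] [MeasureTheory.MeasureSpace Z]
    (g : X → Z) : ENNReal :=
  MeasureTheory.volume (Metric.thickening 1 (Set.range g))

/-!
# Thick embeddings of bounded degree graphs into a cube of optimal size

A graph with `n` vertices and maximal degree `d` is drawn along the integer lattice of a cube of side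
`O(n ^ (1 / (k - 1)))`; the bound on the volume follows from the one on the side, as
`1 + 1 / (k - 1) = k / (k - 1)`. The vertices are placed just below the bottom face, at distinct
points of a `(k - 1)`-dimensional grid, and straight segments fan out from each of them to a private
port on the face for each of its darts (`fan`). It remains to join the ports of the two darts of each
edge by disjoint routes through the cube (`exists_tracks`).

An edge gets a vector of colours in `O(n ^ (1 / (k - 1)))`, and from each of its two ports the route
replaces, one after the other, the coordinates of the port by these colours, until only the
last coordinate of the two ends can differ, and a last run joins them. After `s` replacements a
route runs along a line in direction `s`. It suffices that at each stage such a line belongs to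
one edge only. At the start this holds because the ports are distinct. If it holds at stage `s`, then
only `O(n ^ (1 / (k - 1)))` darts agree outside the coordinates `s` and `s + 1`, because there are
boundedly many for each value of coordinate `s + 1`. Hence a greedy choice of the colour in
coordinate `s` separates the lines of stage `s + 1` (`exists_colour_vectors`). Runs belonging to
different stages are kept apart by giving the stages different residues modulo `k` in the
coordinates they do not change; as `k ≥ 3`, any two stages have such a coordinate in common
(`eq_of_mem_track`).

Geometry enters through one observation: boxes with integral corners that share no lattice point are
at distance at least `1` (`one_le_dist_of_mem_cubicalHull`). So only disjoint connected
sets of lattice points have to be found, and a path without repeated vertices in the grid on such a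
set yields an injective path (`exists_injective_path`). These paths fit together to an injective
continuous map on the compact realisation of the graph, which is therefore an embedding
(`exists_isThickEmbedding`).
-/

/-! ### Maps out of the realisation of a graph -/

namespace GraphRealisation

variable {V : Type*} {G : SimpleGraph V} {Z : Type*}

/-- The map on the realisation that is `φ` on the vertices and follows the path `γ a` along each
dart `a`. -/
def lift [TopologicalSpace Z] (φ : V → Z) (γ : ∀ a : G.Dart, Path (φ a.fst) (φ a.snd))
    (hγ : ∀ a t, γ a.symm (unitInterval.symm t) = γ a t) : GraphRealisation G → Z :=
  Quot.lift (Sum.elim φ fun p => γ p.1 p.2) (by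
    rintro _ _ (a | a | ⟨a, t⟩)
    · exact (γ a).source
    · exact (γ a).target
    · exact (hγ a t).symm)

theorem continuous_lift [TopologicalSpace Z] (φ : V → Z)
    (γ : ∀ a : G.Dart, Path (φ a.fst) (φ a.snd))
    (hγ : ∀ a t, γ a.symm (unitInterval.symm t) = γ a t) : Continuous (lift φ γ hγ) := by
  let _ : TopologicalSpace V := ⊥
  have : DiscreteTopology V := ⟨rfl⟩
  exact continuous_quot_lift _ (Continuous.sumElim (f := φ)
    (g := fun p : (Σ _ : G.Dart, unitInterval) => γ p.1 p.2) continuous_of_discreteTopology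
    (continuous_sigma fun a => (γ a).continuous))

theorem vertex_or_point (x : GraphRealisation G) :
    (∃ v, x = vertex G v) ∨ ∃ a t, x = point G a t := by
  obtain ⟨v | ⟨a, t⟩, rfl⟩ := Quot.exists_rep x
  · exact Or.inl ⟨v, rfl⟩
  · exact Or.inr ⟨a, t, rfl⟩

theorem point_zero (a : G.Dart) : point G a 0 = vertex G a.fst := Quot.sound (.fst a)

theorem point_one (a : G.Dart) : point G a 1 = vertex G a.snd := Quot.sound (.snd a)

theorem point_symm (a : G.Dart) (t : unitInterval) :
    point G a.symm (unitInterval.symm t) = point G a t := (Quot.sound (.symm a t)).symm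

theorem compactSpace [Finite V] : CompactSpace (GraphRealisation G) := by
  let _ : TopologicalSpace V := ⊥
  have : Finite G.Dart := Finite.of_injective _ (SimpleGraph.Dart.toProd_injective (G := G))
  have : CompactSpace (GraphPreRealisation G) :=
    inferInstanceAs (CompactSpace (V ⊕ (Σ _ : G.Dart, unitInterval)))
  exact inferInstanceAs (CompactSpace (Quot (GraphGlue G)))

/-- A family of injective paths along the edges of a finite graph, distinct ones of which meet in
common end vertices only, is a topological embedding of the graph; its thickness can be read off
from the paths. -/
theorem exists_isThickEmbedding [Finite V] [MetricSpace Z] {φ : V → Z}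
    (γ : ∀ a : G.Dart, Path (φ a.fst) (φ a.snd))
    (hγ : ∀ a t, γ a.symm (unitInterval.symm t) = γ a t)
    (hinj : ∀ a, Function.Injective (γ a))
    (hcross : ∀ a b t s, a.edge ≠ b.edge → γ a t = γ b s →
      ∃ v, v ∈ a.edge ∧ v ∈ b.edge ∧ γ a t = φ v)
    (hvv : ∀ v w, v ≠ w → 1 ≤ dist (φ v) (φ w))
    (hev : ∀ (a : G.Dart) v t, v ∉ a.edge → 1 ≤ dist (γ a t) (φ v))
    (hee : ∀ (a b : G.Dart) t s, (∀ v, v ∈ a.edge → v ∉ b.edge) → 1 ≤ dist (γ a t) (γ b s)) :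
    ∃ f : GraphRealisation G → Z, IsThickEmbedding G 1 f ∧
      ∀ x, (∃ v, f x = φ v) ∨ ∃ a t, f x = γ a t := by
  have hφ : Function.Injective φ := fun v w h => by
    by_contra hne
    have := hvv v w hne
    rw [h, dist_self] at this
    linarith
  -- the parameter of a vertex on an edge is `0` or `1`
  have hend : ∀ (a : G.Dart) t v, γ a t = φ v → point G a t = vertex G v := by
    intro a t v h
    have hv : v ∈ a.edge := by
      by_contra hv
      have := hev a v t hv
      rw [h, dist_self] at this
      linarith
    have hv' : v ∈ s(a.fst, a.snd) := hv
    rcases Sym2.mem_iff.1 hv' with rfl | rfl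
    · rw [hinj a (h.trans (γ a).source.symm), point_zero]
    · rw [hinj a (h.trans (γ a).target.symm), point_one]
  have hpp : ∀ a b t s, γ a t = γ b s → point G a t = point G b s := by
    intro a b t s h
    by_cases hab : a.edge = b.edge
    · rcases (SimpleGraph.dart_edge_eq_iff a b).1 hab with rfl | rfl
      · rw [hinj a h]
      · rw [← hγ b s] at h
        rw [hinj _ h, point_symm]
    · obtain ⟨v, -, -, hv⟩ := hcross a b t s hab h
      rw [hend a t v hv, hend b s v (h ▸ hv)]
  have hf : Function.Injective (lift φ γ hγ) := by
    intro x y h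
    rcases vertex_or_point x with ⟨v, rfl⟩ | ⟨a, t, rfl⟩ <;>
      rcases vertex_or_point y with ⟨w, rfl⟩ | ⟨b, s, rfl⟩
    · exact congrArg _ (hφ h)
    · exact (hend b s v h.symm).symm
    · exact hend a t w h
    · exact hpp a b t s h
  have := compactSpace (G := G)
  refine ⟨lift φ γ hγ, ⟨(Continuous.isClosedEmbedding (continuous_lift φ γ hγ) hf).isEmbedding,
    hvv, ?_, ?_⟩, fun x => ?_⟩
  · rintro e v hv _ ⟨a, t, ha, rfl⟩
    exact hev a v t (ha ▸ hv)
  · rintro e e' he _ ⟨a, t, ha, rfl⟩ _ ⟨b, s, hb, rfl⟩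
    exact hee a b t s (by rwa [ha, hb])
  · rcases vertex_or_point x with ⟨v, rfl⟩ | ⟨a, t, rfl⟩
    · exact Or.inl ⟨v, rfl⟩
    · exact Or.inr ⟨a, t, rfl⟩

/-- To embed a graph it is enough to find, for each edge `e`, an injective path between the images of
its ends inside a prescribed set `K e`, if these sets have the required distances and those of
distinct edges meet at images of common ends only. -/
theorem exists_isThickEmbedding_of_sets [Finite V] [MetricSpace Z] {φ : V → Z} {K : Sym2 V → Set Z}
    (hK : ∀ a : G.Dart, ∃ γ : Path (φ a.fst) (φ a.snd), Function.Injective γ ∧ ∀ t, γ t ∈ K a.edge)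
    (hcross : ∀ e e' x, e ≠ e' → x ∈ K e → x ∈ K e' → ∃ v, v ∈ e ∧ v ∈ e' ∧ x = φ v)
    (hvv : ∀ v w, v ≠ w → 1 ≤ dist (φ v) (φ w))
    (hev : ∀ e v x, v ∉ e → x ∈ K e → 1 ≤ dist x (φ v))
    (hee : ∀ e e' x y, (∀ v, v ∈ e → v ∉ e') → x ∈ K e → y ∈ K e' → 1 ≤ dist x y) :
    ∃ f : GraphRealisation G → Z, IsThickEmbedding G 1 f ∧
      ∀ x, (∃ v, f x = φ v) ∨ ∃ e, f x ∈ K e := by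
  classical
  choose γ₀ hinj hmem using hK
  -- a well-order on the vertices orients the edges; the other dart gets the reversed path
  let γ : ∀ a : G.Dart, Path (φ a.fst) (φ a.snd) := fun a =>
    if WellOrderingRel a.fst a.snd then γ₀ a else (γ₀ a.symm).symm
  have hpos : ∀ a : G.Dart, WellOrderingRel a.fst a.snd → γ a = γ₀ a := fun a h => if_pos h
  have hneg : ∀ a : G.Dart, ¬ WellOrderingRel a.fst a.snd → γ a = (γ₀ a.symm).symm :=
    fun a h => if_neg h
  have hγ : ∀ a t, γ a.symm (unitInterval.symm t) = γ a t := by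
    intro a t
    by_cases h : WellOrderingRel a.fst a.snd
    · have h' : ¬ WellOrderingRel a.symm.fst a.symm.snd := asymm_of WellOrderingRel h
      rw [hpos a h, hneg _ h']
      change γ₀ a (unitInterval.symm (unitInterval.symm t)) = γ₀ a t
      rw [unitInterval.symm_symm]
    · have h' : WellOrderingRel a.symm.fst a.symm.snd :=
        ((trichotomous_of WellOrderingRel a.fst a.snd).resolve_left h).resolve_left a.adj.ne
      rw [hneg a h, hpos _ h']
      rfl
  have hγinj : ∀ a, Function.Injective (γ a) := by
    intro a
    by_cases h : WellOrderingRel a.fst a.snd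
    · exact hpos a h ▸ hinj a
    · exact hneg a h ▸ (hinj a.symm).comp unitInterval.symm_bijective.injective
  have hγmem : ∀ a t, γ a t ∈ K a.edge := by
    intro a t
    by_cases h : WellOrderingRel a.fst a.snd
    · exact hpos a h ▸ hmem a t
    · exact hneg a h ▸ a.edge_symm ▸ hmem a.symm (unitInterval.symm t)
  obtain ⟨f, hf, hr⟩ := exists_isThickEmbedding γ hγ hγinj
    (fun a b t s hab h => hcross _ _ _ hab (hγmem a t) (h ▸ hγmem b s)) hvv
    (fun a v t hv => hev _ v _ hv (hγmem a t))
    (fun a b t s hab => hee _ _ _ _ hab (hγmem a t) (hγmem b s))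
  exact ⟨f, hf, fun x => (hr x).imp_right fun ⟨a, t, h⟩ => ⟨a.edge, h ▸ hγmem a t⟩⟩

end GraphRealisation

/-! ### Cubical sets in Euclidean space -/

section CubicalHull

variable {k : ℕ}

/-- The integer lattice inside Euclidean space. -/
noncomputable def latticePoint (z : Fin k → ℤ) : EuclideanSpace ℝ (Fin k) :=
  WithLp.toLp 2 fun i => (z i : ℝ)

@[simp]
theorem latticePoint_apply (z : Fin k → ℤ) (i : Fin k) : latticePoint z i = z i := rfl

theorem latticePoint_injective : Function.Injective (latticePoint (k := k)) := fun z w h => by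
  ext i
  have := congrArg (fun x : EuclideanSpace ℝ (Fin k) => x i) h
  simpa using this

/-- The union of all boxes with integral corners whose lattice points lie in `A`. Disjoint sets of
lattice points have hulls at distance at least `1`, so separation in `ℝ^k` becomes a
combinatorial matter. -/
def cubicalHull (A : Set (Fin k → ℤ)) : Set (EuclideanSpace ℝ (Fin k)) :=
  {x | ∃ l u : Fin k → ℤ, Set.Icc l u ⊆ A ∧ ∀ i, (l i : ℝ) ≤ x i ∧ x i ≤ u i}

theorem cubicalHull_mono {A B : Set (Fin k → ℤ)} (h : A ⊆ B) : cubicalHull A ⊆ cubicalHull B :=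
  fun _ ⟨l, u, hA, hx⟩ => ⟨l, u, hA.trans h, hx⟩

theorem latticePoint_mem_cubicalHull {A : Set (Fin k → ℤ)} {z : Fin k → ℤ} :
    latticePoint z ∈ cubicalHull A ↔ z ∈ A := by
  constructor
  · rintro ⟨l, u, hA, hz⟩
    exact hA ⟨fun i => Int.cast_le.1 (hz i).1, fun i => Int.cast_le.1 (hz i).2⟩
  · intro hz
    exact ⟨z, z, by simpa using hz, fun i => by simp⟩

theorem abs_sub_apply_le_dist (x y : EuclideanSpace ℝ (Fin k)) (i : Fin k) :
    |x i - y i| ≤ dist x y := by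
  rw [dist_eq_norm, ← Real.norm_eq_abs]
  exact PiLp.norm_apply_le (x - y) i

theorem one_le_dist_of_mem_cubicalHull {A B : Set (Fin k → ℤ)} (hAB : Disjoint A B)
    {x y : EuclideanSpace ℝ (Fin k)} (hx : x ∈ cubicalHull A) (hy : y ∈ cubicalHull B) :
    1 ≤ dist x y := by
  obtain ⟨l, u, hA, hx⟩ := hx
  obtain ⟨l', u', hB, hy⟩ := hy
  -- two boxes without a common lattice point are separated in some coordinate
  obtain ⟨i, hi⟩ : ∃ i, u i < l' i ∨ u' i < l i := by
    by_contra! h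
    have hlu : l ≤ u := fun i => by exact_mod_cast (hx i).1.trans (hx i).2
    have hlu' : l' ≤ u' := fun i => by exact_mod_cast (hy i).1.trans (hy i).2
    exact Set.disjoint_left.1 hAB
      (hA ⟨le_sup_left, sup_le hlu fun i => (h i).1⟩)
      (hB ⟨le_sup_right, sup_le (fun i => (h i).2) hlu'⟩)
  refine le_trans ?_ (abs_sub_apply_le_dist x y i)
  have h1 := hx i
  have h2 := hy i
  rcases hi with hi | hi
  · have : (u i : ℝ) + 1 ≤ l' i := by exact_mod_cast hi
    exact le_abs.2 (Or.inr (by linarith))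
  · have : (u' i : ℝ) + 1 ≤ l i := by exact_mod_cast hi
    exact le_abs.2 (Or.inl (by linarith))

/-- Rounding a point down and up stays in every integral box containing it, so two hulls meet in a
single point if the lattice sets do. -/
theorem eq_latticePoint_of_mem_cubicalHull {A B : Set (Fin k → ℤ)} {z : Fin k → ℤ}
    (hAB : A ∩ B ⊆ {z}) {x : EuclideanSpace ℝ (Fin k)} (hA : x ∈ cubicalHull A)
    (hB : x ∈ cubicalHull B) : x = latticePoint z := by
  obtain ⟨l, u, hA, hx⟩ := hA
  obtain ⟨l', u', hB, hy⟩ := hB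
  have h1 : (fun i => ⌊x i⌋) = z := hAB
    ⟨hA ⟨fun i => Int.le_floor.2 (hx i).1, fun i =>
        Int.cast_le.1 ((Int.floor_le (x i)).trans (hx i).2)⟩,
      hB ⟨fun i => Int.le_floor.2 (hy i).1, fun i =>
        Int.cast_le.1 ((Int.floor_le (x i)).trans (hy i).2)⟩⟩
  have h2 : (fun i => ⌈x i⌉) = z := hAB
    ⟨hA ⟨fun i => by exact_mod_cast (hx i).1.trans (Int.le_ceil (x i)),
        fun i => Int.ceil_le.2 (hx i).2⟩,
      hB ⟨fun i => by exact_mod_cast (hy i).1.trans (Int.le_ceil (x i)),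
        fun i => Int.ceil_le.2 (hy i).2⟩⟩
  ext i
  have h1 := congrFun h1 i
  have h2 := congrFun h2 i
  simp only at h1 h2
  have h3 := Int.floor_le (x i)
  have h4 := Int.le_ceil (x i)
  rw [h1] at h3
  rw [h2] at h4
  simpa using le_antisymm h4 h3

theorem segment_mem_cubicalHull (u v : Fin k → ℤ) (t : unitInterval) :
    Path.segment (latticePoint u) (latticePoint v) t ∈ cubicalHull (Set.Icc (u ⊓ v) (u ⊔ v)) := by
  refine ⟨u ⊓ v, u ⊔ v, subset_rfl, fun i => ?_⟩
  have h0 := t.2.1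
  have h1 := t.2.2
  have : Path.segment (latticePoint u) (latticePoint v) t i = (1 - t) * u i + t * v i := by
    simp [Path.segment, AffineMap.lineMap_apply]
    ring
  rw [this]
  simp only [Pi.inf_apply, Pi.sup_apply, Int.cast_min, Int.cast_max]
  constructor
  · have a1 := min_le_left (u i : ℝ) (v i)
    have a2 := min_le_right (u i : ℝ) (v i)
    nlinarith
  · have a1 := le_max_left (u i : ℝ) (v i)
    have a2 := le_max_right (u i : ℝ) (v i)
    nlinarith

end CubicalHull

/-! ### Injective lattice paths -/

section LatticePath

theorem Path.trans_injective {X : Type*} [TopologicalSpace X] {a b c : X} {γ : Path a b}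
    {δ : Path b c} (hγ : Function.Injective γ) (hδ : Function.Injective δ)
    (h : ∀ s t, γ s = δ t → γ s = b) : Function.Injective (γ.trans δ) := by
  have key : ∀ s t : unitInterval, (s : ℝ) ≤ 1 / 2 → ¬ (t : ℝ) ≤ 1 / 2 →
      γ.trans δ s ≠ γ.trans δ t := by
    intro s t hs ht he
    rw [Path.trans_apply, Path.trans_apply, dif_pos hs, dif_neg ht] at he
    have h1 := h _ _ he
    have h2 := congrArg Subtype.val (hδ ((he.symm.trans h1).trans δ.source.symm))
    simp only [Set.Icc.coe_zero] at h2
    push Not at ht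
    linarith
  intro s t he
  by_cases hs : (s : ℝ) ≤ 1 / 2 <;> by_cases ht : (t : ℝ) ≤ 1 / 2
  · rw [Path.trans_apply, Path.trans_apply, dif_pos hs, dif_pos ht] at he
    have := congrArg Subtype.val (hγ he)
    simp only at this
    exact Subtype.ext (by linarith)
  · exact absurd he (key s t hs ht)
  · exact absurd he.symm (key t s ht hs)
  · rw [Path.trans_apply, Path.trans_apply, dif_neg hs, dif_neg ht] at he
    have := congrArg Subtype.val (hδ he)
    simp only at this
    exact Subtype.ext (by linarith)

variable {k : ℕ}

/-- The graph on a set `A` of lattice points in which two distinct points are joined if the box they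
span contains no further lattice point, that is, if they are neighbours in the grid. -/
def latticeGraph (A : Set (Fin k → ℤ)) : SimpleGraph (Fin k → ℤ) where
  Adj u v := u ≠ v ∧ u ∈ A ∧ v ∈ A ∧ Set.Icc (u ⊓ v) (u ⊔ v) ⊆ {u, v}
  symm := ⟨fun u v ⟨h, hu, hv, hI⟩ => ⟨h.symm, hv, hu, by
    rwa [inf_comm, sup_comm, Set.pair_comm]⟩⟩
  loopless := ⟨fun _ h => h.1 rfl⟩

theorem exists_path_of_walk {A : Set (Fin k → ℤ)} {u v : Fin k → ℤ}
    (p : (latticeGraph A).Walk u v) (hp : p.IsPath) :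
    ∃ γ : Path (latticePoint u) (latticePoint v), (u ≠ v → Function.Injective γ) ∧
      ∀ t, γ t ∈ cubicalHull {z | z ∈ p.support} := by
  induction p with
  | nil =>
    refine ⟨Path.refl _, fun h => absurd rfl h, fun t => ?_⟩
    exact latticePoint_mem_cubicalHull.2 (by simp)
  | @cons u v w h p ih =>
    obtain ⟨hp, hu⟩ := (SimpleGraph.Walk.cons_isPath_iff h p).1 hp
    obtain ⟨γ, hγ, hs⟩ := ih hp
    have hseg : Function.Injective (Path.segment (latticePoint u) (latticePoint v)) :=
      Path.segment_injective_of_ne (latticePoint_injective.ne h.1)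
    have hmem : ∀ t, Path.segment (latticePoint u) (latticePoint v) t ∈ cubicalHull {u, v} :=
      fun t => cubicalHull_mono h.2.2.2 (segment_mem_cubicalHull u v t)
    by_cases hvw : v = w
    · subst hvw
      refine ⟨Path.segment _ _, fun _ => hseg, fun t => cubicalHull_mono ?_ (hmem t)⟩
      rintro z (rfl | rfl) <;> simp
    refine ⟨(Path.segment _ _).trans γ, fun _ => Path.trans_injective hseg (hγ hvw) ?_, fun t => ?_⟩
    · intro s t he
      refine eq_latticePoint_of_mem_cubicalHull ?_ (hmem s) (he ▸ hs t)
      rintro z ⟨rfl | rfl, hz⟩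
      · exact absurd hz hu
      · rfl
    · rw [Path.trans_apply]
      split_ifs
      · refine cubicalHull_mono ?_ (hmem _)
        rintro z (rfl | rfl) <;> simp
      · exact cubicalHull_mono (fun z hz => by exact List.mem_cons_of_mem _ hz) (hs _)

theorem mem_of_mem_support {A : Set (Fin k → ℤ)} {u v z : Fin k → ℤ} (hu : u ∈ A)
    (p : (latticeGraph A).Walk u v) (hz : z ∈ p.support) : z ∈ A := by
  induction p with
  | nil => simp_all
  | cons h p ih =>
    rw [SimpleGraph.Walk.support_cons, List.mem_cons] at hz
    rcases hz with rfl | hz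
    · exact hu
    · exact ih h.2.2.1 hz

/-- Two distinct lattice points that are joined in `A` are the ends of an injective path inside the
hull of `A`: it follows a path without repeated vertices in the grid. -/
theorem exists_injective_path {A : Set (Fin k → ℤ)} {u v : Fin k → ℤ} (hu : u ∈ A) (hne : u ≠ v)
    (h : (latticeGraph A).Reachable u v) :
    ∃ γ : Path (latticePoint u) (latticePoint v), Function.Injective γ ∧
      ∀ t, γ t ∈ cubicalHull A := by
  obtain ⟨p, hp⟩ := h.exists_isPath
  obtain ⟨γ, hγ, hs⟩ := exists_path_of_walk p hp
  exact ⟨γ, hγ hne, fun t => cubicalHull_mono (fun z hz => mem_of_mem_support hu p hz) (hs t)⟩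

theorem latticeGraph_adj_update {A : Set (Fin k → ℤ)} {u : Fin k → ℤ} (i : Fin k) (hu : u ∈ A)
    (h : Function.update u i (u i + 1) ∈ A) :
    (latticeGraph A).Adj u (Function.update u i (u i + 1)) := by
  have hle : u ≤ Function.update u i (u i + 1) := by
    rw [le_update_iff]
    exact ⟨by lia, fun _ _ => le_rfl⟩
  refine ⟨fun he => ?_, hu, h, ?_⟩
  · have := congrFun he i
    simp at this
  · rw [inf_eq_left.2 hle, sup_eq_right.2 hle]
    rintro z ⟨h1, h2⟩
    have hz : ∀ j, j ≠ i → z j = u j := fun j hj =>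
      le_antisymm (by simpa [hj] using h2 j) (h1 j)
    have h1 := h1 i
    have h2 := h2 i
    simp only [Function.update_self] at h2
    rcases (show z i = u i ∨ z i = u i + 1 by lia) with hi | hi
    · left
      ext j
      by_cases hj : j = i
      · rw [hj, hi]
      · exact hz j hj
    · right
      ext j
      by_cases hj : j = i
      · subst hj
        rw [hi, Function.update_self]
      · rw [hz j hj, Function.update_of_ne hj]

theorem reachable_of_le {A : Set (Fin k → ℤ)} {u v : Fin k → ℤ} (huv : u ≤ v)
    (h : Set.Icc u v ⊆ A) : (latticeGraph A).Reachable u v := by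
  induction hn : ∑ i, (v i - u i).toNat using Nat.strong_induction_on generalizing u with
  | _ n ih =>
    by_cases he : u = v
    · rw [he]
    obtain ⟨i, hi⟩ : ∃ i, u i < v i := by
      by_contra! hc
      exact he (le_antisymm huv hc)
    have hle : u ≤ Function.update u i (u i + 1) := by
      rw [le_update_iff]
      exact ⟨by lia, fun _ _ => le_rfl⟩
    have hle' : Function.update u i (u i + 1) ≤ v := by
      rw [update_le_iff]
      exact ⟨hi, fun j _ => huv j⟩
    refine (latticeGraph_adj_update i (h ⟨le_rfl, huv⟩) (h ⟨hle, hle'⟩)).reachable.trans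
      (ih _ ?_ hle' (fun z hz => h ⟨hle.trans hz.1, hz.2⟩) rfl)
    rw [← hn]
    refine Finset.sum_lt_sum (fun j _ => ?_) ⟨i, Finset.mem_univ _, ?_⟩
    · have := hle j
      lia
    · rw [Function.update_self]
      lia

theorem reachable_of_mem_Icc {A : Set (Fin k → ℤ)} {l m u v : Fin k → ℤ} (h : Set.Icc l m ⊆ A)
    (hu : u ∈ Set.Icc l m) (hv : v ∈ Set.Icc l m) : (latticeGraph A).Reachable u v :=
  (reachable_of_le hu.1 fun _ hz => h ⟨hz.1, hz.2.trans hu.2⟩).symm.trans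
    (reachable_of_le hv.1 fun _ hz => h ⟨hz.1, hz.2.trans hv.2⟩)

end LatticePath

/-! ### Greedy colouring of waypoints -/

section Waypoints

open Finset

/-- If each fibre of `key` has at most `N` elements and at most two elements lie over
each `e`, greedy colouring of the `e` separates those sharing a key. -/
theorem exists_separating_colouring {D E X : Type*} [Fintype D] [Finite E] (π : D → E)
    (key : D → X) (N : ℕ) (hπ : ∀ e, {a | π a = e}.ncard ≤ 2)
    (hkey : ∀ x, {a | key a = x}.ncard ≤ N) :
    ∃ c : E → ℕ, (∀ e, c e ≤ 2 * N) ∧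
      ∀ a b, key a = key b → c (π a) = c (π b) → π a = π b := by
  classical
  have := Fintype.ofFinite E
  suffices h : ∀ s : Finset E, ∃ c : E → ℕ, (∀ e, c e ≤ 2 * N) ∧
      ∀ a b, π a ∈ s → π b ∈ s → key a = key b → c (π a) = c (π b) → π a = π b by
    obtain ⟨c, hc, h⟩ := h Finset.univ
    exact ⟨c, hc, fun a b => h a b (Finset.mem_univ _) (Finset.mem_univ _)⟩
  intro s
  induction s using Finset.induction_on with
  | empty => exact ⟨fun _ => 0, by simp⟩
  | insert e s he ih =>
    obtain ⟨c, hc, h⟩ := ih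
    -- the colours of the elements sharing a key with `e` are forbidden
    let F : Finset ℕ :=
      ((univ.filter (π · = e)).biUnion fun a => univ.filter (key · = key a)).image fun b => c (π b)
    have hF : F.card < (range (2 * N + 1)).card := by
      rw [card_range]
      refine Nat.lt_succ_of_le (card_image_le.trans ((card_biUnion_le_card_mul _ _ N ?_).trans ?_))
      · intro a _
        rw [← Set.ncard_coe_finset]
        simpa using hkey (key a)
      · refine Nat.mul_le_mul_right _ ?_
        rw [← Set.ncard_coe_finset]
        simpa using hπ e
    obtain ⟨n, hn, hnF⟩ := exists_mem_notMem_of_card_lt_card hF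
    have hnew : ∀ a b, π a = e → π b ∈ s → key a = key b → n ≠ c (π b) := by
      rintro a b ha - hab rfl
      refine hnF (mem_image.2 ⟨b, mem_biUnion.2 ⟨a, ?_, ?_⟩, rfl⟩) <;> simp [ha, hab]
    refine ⟨Function.update c e n, fun e' => ?_, fun a b ha hb hab hcab => ?_⟩
    · by_cases he' : e' = e
      · subst he'
        simpa [Nat.lt_succ_iff] using hn
      · rw [Function.update_of_ne he']
        exact hc e'
    · rcases Finset.mem_insert.1 ha with ha | ha <;> rcases Finset.mem_insert.1 hb with hb | hb
      · rw [ha, hb]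
      · rw [ha, Function.update_self, Function.update_of_ne (ne_of_mem_of_not_mem hb he)] at hcab
        exact absurd hcab (hnew a b ha hb hab)
      · rw [hb, Function.update_self, Function.update_of_ne (ne_of_mem_of_not_mem ha he)] at hcab
        exact absurd hcab.symm (hnew b a hb ha hab.symm)
      · rw [Function.update_of_ne (ne_of_mem_of_not_mem ha he),
          Function.update_of_ne (ne_of_mem_of_not_mem hb he)] at hcab
        exact h a b ha hb hab hcab

variable {D E : Type*} {k : ℕ}

/-- The cell that an end `a` of the edge `π a` has reached after `s` stages of its route: the first
`s` coordinates of the cell `pos a` have been replaced by those of the colour vector of the edge. -/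
def waypoint (π : D → E) (pos : D → Fin k → ℤ) (c : E → Fin k → ℤ) (s : ℕ) (a : D) : Fin k → ℤ :=
  fun i => if (i : ℕ) < s then c (π a) i else pos a i

/-- Colour vectors can be chosen so that at each stage `s` a line of cells in direction `s` is used
by the ends of one edge only. The colour in direction `s` has to separate the edges that
would share a line in direction `s + 1`; as those lie on different lines in direction `s`, there are
boundedly many per coordinate in direction `s + 1`. -/
theorem exists_colour_vectors [Finite D] [Finite E] (π : D → E)
    (hπ : ∀ e, {a | π a = e}.ncard ≤ 2) (pos : D → Fin k → ℤ) (m : ℕ)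
    (hpos : ∀ a i, 0 ≤ pos a i ∧ pos a i < m)
    (hinj : ∀ a b, (∀ i : Fin k, (i : ℕ) ≠ 0 → pos a i = pos b i) → π a = π b) :
    ∃ c : E → Fin k → ℤ, (∀ e i, 1 ≤ c e i ∧ c e i ≤ 4 * m + 1) ∧
      ∀ s : ℕ, s < k → ∀ a b, (∀ i : Fin k, (i : ℕ) ≠ s →
        waypoint π pos c s a i = waypoint π pos c s b i) → π a = π b := by
  classical
  have := Fintype.ofFinite D
  suffices h : ∀ r : ℕ, ∃ c : E → Fin k → ℤ, (∀ e i, 1 ≤ c e i ∧ c e i ≤ 4 * m + 1) ∧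
      ∀ s : ℕ, s ≤ r → s < k → ∀ a b, (∀ i : Fin k, (i : ℕ) ≠ s →
        waypoint π pos c s a i = waypoint π pos c s b i) → π a = π b by
    obtain ⟨c, hc, h⟩ := h k
    exact ⟨c, hc, fun s hs => h s hs.le hs⟩
  intro r
  induction r with
  | zero =>
    refine ⟨fun _ _ => 1, fun _ _ => by constructor <;> lia, fun s hs _ a b h => hinj a b ?_⟩
    obtain rfl : s = 0 := by lia
    simpa [waypoint] using h
  | succ r ih =>
    obtain ⟨c, hc, h⟩ := ih
    by_cases hr : r + 1 < k
    swap
    · exact ⟨c, hc, fun s hs hsk => h s (by lia) hsk⟩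
    let key : D → Fin k → ℤ := fun a i =>
      if (i : ℕ) = r ∨ (i : ℕ) = r + 1 then 0 else waypoint π pos c r a i
    have hkey : ∀ x, {a | key a = x}.ncard ≤ 2 * m := by
      intro x
      have hS : ({a | key a = x} : Set D) = (univ.filter (key · = x) : Finset D) := by simp
      have hm : (Finset.Ico (0 : ℤ) m).card = m := by simp
      rw [hS, Set.ncard_coe_finset, ← hm]
      refine card_le_mul_card_image_of_maps_to (f := fun a => pos a ⟨r + 1, hr⟩)
        (fun a _ => Finset.mem_Ico.2 (hpos a _)) 2 fun y _ => ?_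
      -- elements of a fibre that agree in coordinate `r + 1` share a line in direction `r`
      rcases Finset.eq_empty_or_nonempty
        (univ.filter (key · = x) |>.filter fun a => pos a ⟨r + 1, hr⟩ = y) with he | ⟨a, ha⟩
      · rw [he]
        simp
      · refine le_trans ?_ (hπ (π a))
        rw [← Set.ncard_coe_finset]
        refine Set.ncard_le_ncard (fun b hb => ?_) (Set.toFinite _)
        simp only [mem_filter, mem_univ, true_and] at ha
        simp only [coe_filter, mem_filter, mem_univ, true_and] at hb
        refine h r le_rfl (by lia) b a fun i hi => ?_
        by_cases hi' : (i : ℕ) = r + 1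
        · obtain rfl : i = ⟨r + 1, hr⟩ := Fin.ext hi'
          simp [waypoint, hb.2, ha.2]
        · have := congrFun (hb.1.trans ha.1.symm) i
          simpa [key, hi, hi'] using this
    obtain ⟨n, hn, hsep⟩ := exists_separating_colouring π key (2 * m) hπ hkey
    refine ⟨fun e i => if (i : ℕ) = r then n e + 1 else c e i, fun e i => ?_,
      fun s hs hsk a b hab => ?_⟩
    · have := hn e
      have := hc e i
      dsimp only
      split_ifs <;> constructor <;> lia
    · rcases Nat.lt_or_ge r s with hrs | hrs
      · obtain rfl : s = r + 1 := by lia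
        refine hsep a b ?_ ?_
        · ext i
          have := hab i
          simp only [key]
          split_ifs with hi
          · rfl
          · simp only [waypoint] at this ⊢
            grind
        · have := hab ⟨r, by lia⟩
          simp [waypoint] at this
          exact this
      · refine h s hrs hsk a b fun i hi => ?_
        have := hab i hi
        simp only [waypoint] at this ⊢
        grind

end Waypoints

/-! ### Disjoint tracks in the lattice -/

section Tracks

variable {D E : Type*} {k : ℕ}

/-- The lattice point at which the route of `a` starts: the origin of the cell `pos a`, where a cell
is a half-open cube of side `k`. -/
def port (pos : D → Fin k → ℤ) (a : D) : Fin k → ℤ := fun i => k * pos a i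

/-- The lattice points of `[0, N]^k` reserved for the edge `e`. At stage `s`, an end of `e` runs in
direction `s` with all other coordinates congruent to `s` modulo `k`, and then moves
inside one cell to where all coordinates are congruent to `s + 1`. The residues keep the runs of
different stages apart, and the waypoints those of the same stage. -/
def track (π : D → E) (pos : D → Fin k → ℤ) (c : E → Fin k → ℤ) (N : ℤ) (e : E) :
    Set (Fin k → ℤ) :=
  {x | (∀ i, 0 ≤ x i ∧ x i ≤ N) ∧ ∃ a, π a = e ∧ ∃ s : ℕ,
    (s < k ∧ ∀ i : Fin k, (i : ℕ) ≠ s → x i = k * waypoint π pos c s a i + s) ∨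
    (s + 1 < k ∧ ∀ i : Fin k, k * waypoint π pos c (s + 1) a i + s ≤ x i ∧
      x i ≤ k * waypoint π pos c (s + 1) a i + s + 1)}

variable {π : D → E} {pos : D → Fin k → ℤ} {c : E → Fin k → ℤ} {N : ℤ}

theorem waypoint_succ_of_ne {s : ℕ} {i : Fin k} (a : D) (h : (i : ℕ) ≠ s) :
    waypoint π pos c (s + 1) a i = waypoint π pos c s a i := by
  simp only [waypoint]
  grind

theorem ediv_emod_of_eq {x y r k : ℤ} (h : x = k * y + r) (h0 : 0 ≤ r) (hr : r < k) :
    x / k = y ∧ x % k = r := by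
  rw [Int.ediv_emod_unique (by lia)]
  exact ⟨by lia, h0, hr⟩

theorem eq_of_mem_track (hk : 3 ≤ k)
    (hsep : ∀ s : ℕ, s < k → ∀ a b, (∀ i : Fin k, (i : ℕ) ≠ s →
      waypoint π pos c s a i = waypoint π pos c s b i) → π a = π b)
    {e e' : E} {x : Fin k → ℤ} (hx : x ∈ track π pos c N e) (hx' : x ∈ track π pos c N e') :
    e = e' := by
  obtain ⟨-, a, rfl, s, h⟩ := hx
  obtain ⟨-, b, rfl, t, h'⟩ := hx'
  have hline : ∀ {a : D} {s : ℕ}, s < k →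
      (∀ i : Fin k, (i : ℕ) ≠ s → x i = k * waypoint π pos c s a i + s) →
      ∀ i : Fin k, (i : ℕ) ≠ s → x i / k = waypoint π pos c s a i ∧ x i % k = s :=
    fun hs h i hi => ediv_emod_of_eq (h i hi) (by lia) (by lia)
  have hturn : ∀ {a : D} {s : ℕ}, s + 1 < k →
      (∀ i : Fin k, k * waypoint π pos c (s + 1) a i + s ≤ x i ∧
        x i ≤ k * waypoint π pos c (s + 1) a i + s + 1) →
      ∀ i : Fin k, x i / k = waypoint π pos c (s + 1) a i ∧ (x i % k = s ∨ x i % k = s + 1) := by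
    intro a s hs h i
    have := h i
    rcases (show x i = k * waypoint π pos c (s + 1) a i + s ∨
      x i = k * waypoint π pos c (s + 1) a i + (s + 1) by lia) with h | h
    · have := ediv_emod_of_eq h (by lia) (by lia)
      exact ⟨this.1, Or.inl this.2⟩
    · have := ediv_emod_of_eq h (by lia) (by lia)
      exact ⟨this.1, Or.inr this.2⟩
  -- two runs are compared in a coordinate that neither of them changes
  have hthird : ∀ s t : ℕ, ∃ i : Fin k, (i : ℕ) ≠ s ∧ (i : ℕ) ≠ t := by
    intro s t
    rcases (show (0 ≠ s ∧ 0 ≠ t) ∨ (1 ≠ s ∧ 1 ≠ t) ∨ (2 ≠ s ∧ 2 ≠ t) by lia) with h | h | h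
    · exact ⟨⟨0, by lia⟩, h⟩
    · exact ⟨⟨1, by lia⟩, h⟩
    · exact ⟨⟨2, by lia⟩, h⟩
  have hmixed : ∀ {a b : D} {s t : ℕ}, s < k → t + 1 < k →
      (∀ i : Fin k, (i : ℕ) ≠ s → x i / k = waypoint π pos c s a i ∧ x i % k = s) →
      (∀ i : Fin k, x i / k = waypoint π pos c (t + 1) b i ∧ (x i % k = t ∨ x i % k = t + 1)) →
      π a = π b := by
    intro a b s t hs ht h h'
    obtain ⟨i, hi, -⟩ := hthird s s
    have h1 := (h i hi).2
    rcases (show s = t ∨ s = t + 1 by have := (h' i).2; lia) with rfl | rfl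
    · refine hsep s hs a b fun i hi => ?_
      rw [← (h i hi).1, (h' i).1, waypoint_succ_of_ne b hi]
    · exact hsep _ hs a b fun i hi => by rw [← (h i hi).1, (h' i).1]
  rcases h with ⟨hs, h⟩ | ⟨hs, h⟩ <;> rcases h' with ⟨ht, h'⟩ | ⟨ht, h'⟩
  · replace h := hline hs h
    replace h' := hline ht h'
    obtain ⟨i, hi, hi'⟩ := hthird s t
    obtain rfl : s = t := by
      have h1 := (h i hi).2
      have h2 := (h' i hi').2
      lia
    exact hsep s hs a b fun i hi => by rw [← (h i hi).1, (h' i hi).1]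
  · exact hmixed hs ht (hline hs h) (hturn ht h')
  · exact (hmixed ht hs (hline ht h') (hturn hs h)).symm
  · replace h := hturn hs h
    replace h' := hturn ht h'
    have h1 := (h ⟨0, by lia⟩).2
    have h2 := (h' ⟨0, by lia⟩).2
    rcases (show s = t ∨ t = s + 1 ∨ s = t + 1 by lia) with rfl | rfl | rfl
    · exact hsep _ hs a b fun i _ => by rw [← (h i).1, (h' i).1]
    · refine hsep _ hs a b fun i hi => ?_
      rw [← (h i).1, (h' i).1, waypoint_succ_of_ne b hi]
    · refine hsep _ ht a b fun i hi => ?_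
      rw [← (h' i).1, (h i).1, waypoint_succ_of_ne a hi]

theorem port_mem_track (hk : 0 < k) (a : D) (hport : ∀ i, 0 ≤ port pos a i ∧ port pos a i ≤ N) :
    port pos a ∈ track π pos c N (π a) :=
  ⟨hport, a, rfl, 0, Or.inl ⟨hk, fun i _ => by simp [port, waypoint]⟩⟩

/-- The colours are positive, so a track leaves the bottom face along the first runs and never comes
back to it. -/
theorem eq_port_of_mem_track (hpos : ∀ a (i : Fin k), (i : ℕ) = 0 → pos a i = 0)
    (hc : ∀ e i, 1 ≤ c e i) {e : E} {x : Fin k → ℤ} (hx : x ∈ track π pos c N e) {j : Fin k}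
    (hj : (j : ℕ) = 0) (hxj : x j = 0) : ∃ a, π a = e ∧ x = port pos a := by
  have hk : (0 : ℤ) < k := by have := j.2; lia
  obtain ⟨-, a, ha, s, ⟨hs, h⟩ | ⟨hs, h⟩⟩ := hx
  · refine ⟨a, ha, ?_⟩
    by_cases hs0 : s = 0
    · subst hs0
      ext i
      by_cases hi : (i : ℕ) = 0
      · obtain rfl : i = j := Fin.ext (hi.trans hj.symm)
        simp [port, hxj, hpos a i hj]
      · simpa [port, waypoint] using h i hi
    · have h1 := h j (by lia)
      have h2 := hc (π a) j
      simp only [waypoint, hj, Nat.pos_of_ne_zero hs0, if_true] at h1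
      nlinarith
  · have h1 := (h j).1
    have h2 := hc (π a) j
    simp only [waypoint, hj, Nat.succ_pos, if_true] at h1
    nlinarith

/-- The points at which the stages of a route begin are joined to its port inside the track. -/
theorem reachable_corner {M : ℤ} (hN : k * (M + 1) ≤ N) (hM : ∀ s a i,
      0 ≤ waypoint π pos c s a i ∧ waypoint π pos c s a i ≤ M)
    {s : ℕ} (hs : s < k) (a : D) : (latticeGraph (track π pos c N (π a))).Reachable (port pos a)
      fun i => k * waypoint π pos c s a i + s := by
  induction s with
  | zero =>
    simp only [waypoint, Nat.not_lt_zero, if_false, Nat.cast_zero, add_zero]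
    rfl
  | succ s ih =>
    have hbound : ∀ (t : ℕ) i (r : ℤ), 0 ≤ r → r < k → 0 ≤ k * waypoint π pos c t a i + r ∧
        k * waypoint π pos c t a i + r ≤ N := by
      intro t i r h0 hr
      obtain ⟨h1, h2⟩ := hM t a i
      constructor <;> nlinarith
    have hs' : s < k := by lia
    refine (ih hs').trans (SimpleGraph.Reachable.trans
      (v := fun i => k * waypoint π pos c (s + 1) a i + s) ?_ ?_)
    · refine reachable_of_mem_Icc
        (l := fun i => if (i : ℕ) = s then 0 else k * waypoint π pos c s a i + s)
        (m := fun i => if (i : ℕ) = s then N else k * waypoint π pos c s a i + s) ?_ ?_ ?_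
      · rintro x ⟨h1, h2⟩
        refine ⟨fun i => ?_, a, rfl, s, Or.inl ⟨hs', fun i hi => ?_⟩⟩
        · have h1 := h1 i
          have h2 := h2 i
          have := hbound s i s (by lia) (by lia)
          simp only at h1 h2
          split_ifs at h1 h2 <;> lia
        · have h1 := h1 i
          have h2 := h2 i
          simp only [hi, if_false] at h1 h2
          lia
      · constructor <;> intro i <;> dsimp only <;> split_ifs <;>
          first
          | exact (hbound s i s (by lia) (by lia)).1
          | exact (hbound s i s (by lia) (by lia)).2
          | exact le_rfl
      · constructor <;> intro i <;> dsimp only <;> split_ifs with hi <;>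
          first
          | exact (hbound (s + 1) i s (by lia) (by lia)).1
          | exact (hbound (s + 1) i s (by lia) (by lia)).2
          | exact (waypoint_succ_of_ne (π := π) (pos := pos) (c := c) a hi ▸ le_rfl)
    · refine reachable_of_le (fun i => by simp) ?_
      rintro x ⟨h1, h2⟩
      refine ⟨fun i => ?_, a, rfl, s, Or.inr ⟨hs, fun i => ?_⟩⟩
      · have h1 := h1 i
        have h2 := h2 i
        have b1 := hbound (s + 1) i s (by lia) (by lia)
        have b2 := hbound (s + 1) i (s + 1) (by lia) (by lia)
        push_cast at h1 h2
        lia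
      · have h1 := h1 i
        have h2 := h2 i
        push_cast at h1 h2
        exact ⟨h1, by lia⟩

theorem reachable_port {M : ℤ} (hk : 0 < k) (hN : k * (M + 1) ≤ N) (hM : ∀ s a i,
      0 ≤ waypoint π pos c s a i ∧ waypoint π pos c s a i ≤ M) {a b : D} (hab : π a = π b) :
    (latticeGraph (track π pos c N (π a))).Reachable (port pos a) (port pos b) := by
  have ha := reachable_corner hN hM (show k - 1 < k by lia) a
  have hb := reachable_corner hN hM (show k - 1 < k by lia) b
  rw [← hab] at hb
  refine ha.trans (SimpleGraph.Reachable.trans ?_ hb.symm)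
  have hbound : ∀ a i, 0 ≤ k * waypoint π pos c (k - 1) a i + ((k - 1 : ℕ) : ℤ) ∧
      k * waypoint π pos c (k - 1) a i + ((k - 1 : ℕ) : ℤ) ≤ N := by
    intro a i
    obtain ⟨h1, h2⟩ := hM (k - 1) a i
    have : (((k - 1 : ℕ) : ℤ)) < k := by lia
    constructor <;> nlinarith
  -- before the last run both ends have reached the same line
  have heq : ∀ i : Fin k, (i : ℕ) ≠ k - 1 →
      waypoint π pos c (k - 1) a i = waypoint π pos c (k - 1) b i := by
    intro i hi
    have : (i : ℕ) < k - 1 := by have := i.2; lia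
    simp [waypoint, this, hab]
  refine reachable_of_mem_Icc
    (l := fun i => if (i : ℕ) = k - 1 then 0 else
      k * waypoint π pos c (k - 1) a i + ((k - 1 : ℕ) : ℤ))
    (m := fun i => if (i : ℕ) = k - 1 then N else
      k * waypoint π pos c (k - 1) a i + ((k - 1 : ℕ) : ℤ)) ?_ ?_ ?_
  · rintro x ⟨h1, h2⟩
    refine ⟨fun i => ?_, a, rfl, k - 1, Or.inl ⟨by lia, fun i hi => ?_⟩⟩
    · have h1 := h1 i
      have h2 := h2 i
      have := hbound a i
      simp only at h1 h2
      split_ifs at h1 h2 <;> lia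
    · have h1 := h1 i
      have h2 := h2 i
      simp only [hi, if_false] at h1 h2
      lia
  · constructor <;> intro i <;> dsimp only <;> split_ifs <;>
      first
      | exact (hbound a i).1
      | exact (hbound a i).2
      | exact le_rfl
  · constructor <;> intro i <;> dsimp only <;> split_ifs with hi <;>
      first
      | exact (hbound b i).1
      | exact (hbound b i).2
      | exact (heq i hi ▸ le_rfl)

/-- Finitely many edges with ends at distinct cells of the bottom face of a cube of side `m`
can be joined by disjoint connected sets of lattice points in a cube of side `O(m)`. -/
theorem exists_tracks [Finite D] [Finite E] (hk : 3 ≤ k) (π : D → E)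
    (hπ : ∀ e, {a | π a = e}.ncard ≤ 2) (pos : D → Fin k → ℤ) (m : ℕ)
    (hpos : ∀ a i, 0 ≤ pos a i ∧ pos a i < m)
    (hpos0 : ∀ a (i : Fin k), (i : ℕ) = 0 → pos a i = 0)
    (hinj : Function.Injective pos) :
    ∃ S : E → Set (Fin k → ℤ),
      (∀ e, ∀ x ∈ S e, ∀ i, 0 ≤ x i ∧ x i ≤ k * (4 * m + 2)) ∧
      (∀ a, port pos a ∈ S (π a)) ∧
      (∀ a b, π a = π b → (latticeGraph (S (π a))).Reachable (port pos a) (port pos b)) ∧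
      (∀ e e', e ≠ e' → Disjoint (S e) (S e')) ∧
      (∀ e, ∀ x ∈ S e, ∀ i : Fin k, (i : ℕ) = 0 → x i = 0 → ∃ a, π a = e ∧ x = port pos a) := by
  obtain ⟨c, hc, hsep⟩ := exists_colour_vectors π hπ pos m hpos fun a b h => by
    refine congrArg π (hinj (funext fun i => ?_))
    by_cases hi : (i : ℕ) = 0
    · rw [hpos0 a i hi, hpos0 b i hi]
    · exact h i hi
  have hM : ∀ s a i, 0 ≤ waypoint π pos c s a i ∧ waypoint π pos c s a i ≤ 4 * m + 1 := by
    intro s a i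
    have h1 := hc (π a) i
    have h2 := hpos a i
    simp only [waypoint]
    split_ifs <;> lia
  have hN : (k : ℤ) * ((4 * m + 1) + 1) ≤ k * (4 * m + 2) := by lia
  refine ⟨track π pos c (k * (4 * m + 2)), fun e x hx => hx.1, fun a => ?_, fun a b hab => ?_,
    fun e e' hne => ?_, fun e x hx i hi hxi => ?_⟩
  · refine port_mem_track (by lia) a fun i => ?_
    have := hpos a i
    simp only [port]
    constructor
    · exact mul_nonneg (by lia) this.1
    · exact mul_le_mul_of_nonneg_left (by lia) (by lia)
  · exact reachable_port (by lia) hN hM hab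
  · exact Set.disjoint_left.2 fun x hx hx' => hne (eq_of_mem_track hk hsep hx hx')
  · exact eq_port_of_mem_track hpos0 (fun e i => (hc e i).1) hx hi hxi

end Tracks

/-! ### Thick embeddings into a cube -/

section Fans

variable {V : Type*} {k : ℕ}

/-- The cell on the bottom face reserved for the dart `a`. The vertex `v` owns a cube of side `D`
of the face, with corner `D • p v`, and its darts, numbered by `idx`, use the diagonal of it. -/
def dartCell {G : SimpleGraph V} (D : ℕ) (p : V → Fin k → ℤ) (idx : G.Dart → ℕ) (a : G.Dart) :
    Fin k → ℤ :=
  fun i => if (i : ℕ) = 0 then 0 else D * p a.fst i + idx a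

/-- The position of the vertex `v`, one unit below the bottom face. -/
def fanRoot (D : ℕ) (p : V → Fin k → ℤ) (v : V) : Fin k → ℤ :=
  fun i => if (i : ℕ) = 0 then -1 else k * (D * p v i)

/-- The corner opposite to `fanRoot` of a box containing the segments that join the vertex `v` to
the ports of its darts. -/
def fanTop (D : ℕ) (p : V → Fin k → ℤ) (v : V) : Fin k → ℤ :=
  fun i => if (i : ℕ) = 0 then 0 else k * (D * p v i + (D - 1))

/-- The straight path from the vertex at which the dart `a` starts to the port of `a`. -/
noncomputable def fan {G : SimpleGraph V} (D : ℕ) (p : V → Fin k → ℤ) (idx : G.Dart → ℕ)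
    (a : G.Dart) :
    Path (latticePoint (fanRoot D p a.fst)) (latticePoint (port (dartCell D p idx) a)) :=
  Path.segment _ _

variable {G : SimpleGraph V} {D : ℕ} {p : V → Fin k → ℤ} {idx : G.Dart → ℕ}

theorem fan_apply (a : G.Dart) (t : unitInterval) (i : Fin k) :
    fan D p idx a t i = (if (i : ℕ) = 0 then -1 + (t : ℝ) else
      k * (D * p a.fst i + t * idx a)) := by
  by_cases hi : (i : ℕ) = 0
  · simp [fan, Path.segment, AffineMap.lineMap_apply, port, dartCell, fanRoot, hi]
    ring
  · simp [fan, Path.segment, AffineMap.lineMap_apply, port, dartCell, fanRoot, hi]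
    ring

theorem fanRoot_le_fanTop (hD : 0 < D) (v : V) : fanRoot D p v ≤ fanTop D p v := fun i => by
  simp only [fanRoot, fanTop]
  split_ifs
  · lia
  · exact mul_le_mul_of_nonneg_left (by lia) (by lia)

theorem port_mem_fanBox (hidx : ∀ a, idx a < D) (a : G.Dart) :
    port (dartCell D p idx) a ∈ Set.Icc (fanRoot D p a.fst) (fanTop D p a.fst) := by
  have := hidx a
  constructor <;> intro i <;> simp only [port, dartCell, fanRoot, fanTop] <;> split_ifs <;>
    first
    | lia
    | exact mul_le_mul_of_nonneg_left (by lia) (by lia)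

theorem fan_mem_cubicalHull (hidx : ∀ a, idx a < D) (a : G.Dart) (t : unitInterval) :
    fan D p idx a t ∈ cubicalHull (Set.Icc (fanRoot D p a.fst) (fanTop D p a.fst)) := by
  have h := port_mem_fanBox (p := p) hidx a
  refine cubicalHull_mono (Set.Icc_subset_Icc (le_inf le_rfl h.1) (sup_le (h.1.trans h.2) h.2))
    (segment_mem_cubicalHull _ _ t)

theorem disjoint_fanBox (hk : 0 < k) (hp : Function.Injective p)
    (hp0 : ∀ v (i : Fin k), (i : ℕ) = 0 → p v i = 0) {v w : V} (h : v ≠ w) :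
    Disjoint (Set.Icc (fanRoot D p v) (fanTop D p v)) (Set.Icc (fanRoot D p w) (fanTop D p w)) := by
  refine Set.disjoint_left.2 fun x hv hw => h (hp (funext fun i => ?_))
  by_cases hi : (i : ℕ) = 0
  · rw [hp0 v i hi, hp0 w i hi]
  have h1 := (hv.1 i).trans (hw.2 i)
  have h2 := (hw.1 i).trans (hv.2 i)
  simp only [fanRoot, fanTop, hi, if_false] at h1 h2
  replace h1 := le_of_mul_le_mul_left h1 (by lia)
  replace h2 := le_of_mul_le_mul_left h2 (by lia)
  rcases lt_trichotomy (p v i) (p w i) with h | h | h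
  · nlinarith
  · exact h
  · nlinarith

theorem dartCell_injective (hk : 1 < k) (hp : Function.Injective p)
    (hp0 : ∀ v (i : Fin k), (i : ℕ) = 0 → p v i = 0) (hidx : ∀ a, idx a < D)
    (hinj : ∀ a b, a.fst = b.fst → idx a = idx b → a = b) :
    Function.Injective (dartCell D p idx) := by
  intro a b h
  have hport : port (dartCell D p idx) a = port (dartCell D p idx) b := by
    ext i
    simp only [port, h]
  have hab : a.fst = b.fst := by
    by_contra hne
    exact Set.disjoint_left.1 (disjoint_fanBox (D := D) (by lia) hp hp0 hne)
      (port_mem_fanBox hidx a) (hport ▸ port_mem_fanBox hidx b)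
  refine hinj a b hab ?_
  have := congrFun h ⟨1, hk⟩
  simp only [dartCell, one_ne_zero, if_false, hab] at this
  lia

/-- The segments of one vertex meet in that vertex only, and those of distinct vertices do not meet
at all. -/
theorem fan_eq_fan (hk : 1 < k) (hp : Function.Injective p)
    (hp0 : ∀ v (i : Fin k), (i : ℕ) = 0 → p v i = 0) (hidx : ∀ a, idx a < D)
    (hinj : ∀ a b, a.fst = b.fst → idx a = idx b → a = b) {a b : G.Dart} {t s : unitInterval}
    (hab : a ≠ b) (h : fan D p idx a t = fan D p idx b s) :
    a.fst = b.fst ∧ fan D p idx a t = latticePoint (fanRoot D p a.fst) := by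
  have hfst : a.fst = b.fst := by
    by_contra hne
    have := one_le_dist_of_mem_cubicalHull (disjoint_fanBox (D := D) (by lia) hp hp0 hne)
      (fan_mem_cubicalHull hidx a t) (fan_mem_cubicalHull hidx b s)
    rw [h, dist_self] at this
    linarith
  have h0 : ((t : ℝ)) = s := by
    have := congrArg (fun x : EuclideanSpace ℝ (Fin k) => x ⟨0, by lia⟩) h
    simpa [fan_apply] using this
  have h1 := congrArg (fun x : EuclideanSpace ℝ (Fin k) => x ⟨1, hk⟩) h
  simp only [fan_apply, one_ne_zero, if_false, hfst, ← h0] at h1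
  have hk' : (k : ℝ) ≠ 0 := by
    have : 0 < k := by lia
    positivity
  have h2 : (t : ℝ) * idx a = t * idx b := by
    have := mul_left_cancel₀ hk' h1
    linarith
  have ht : t = 0 := by
    by_contra ht
    refine hab (hinj a b hfst ?_)
    have := mul_left_cancel₀ (fun h => ht (Subtype.ext h)) h2
    exact_mod_cast this
  rw [ht]
  exact ⟨hfst, (fan D p idx a).source⟩

theorem apply_bounds_of_mem_cubicalHull {A : Set (Fin k → ℤ)} {l u : ℤ}
    (hA : ∀ z ∈ A, ∀ i, l ≤ z i ∧ z i ≤ u) {x : EuclideanSpace ℝ (Fin k)} (hx : x ∈ cubicalHull A)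
    (i : Fin k) : (l : ℝ) ≤ x i ∧ x i ≤ u := by
  obtain ⟨l', u', hA', hx⟩ := hx
  have hle : l' ≤ u' := fun i => Int.cast_le.1 ((hx i).1.trans (hx i).2)
  exact ⟨(Int.cast_le.2 (hA _ (hA' ⟨le_rfl, hle⟩) i).1).trans (hx i).1,
    (hx i).2.trans (Int.cast_le.2 (hA _ (hA' ⟨hle, le_rfl⟩) i).2)⟩

theorem ncard_dart_edge_eq_le_two (e : Sym2 V) : {a : G.Dart | a.edge = e}.ncard ≤ 2 := by
  rcases Set.eq_empty_or_nonempty {a : G.Dart | a.edge = e} with h | ⟨a, rfl⟩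
  · simp [h]
  · refine (Set.ncard_le_ncard (t := {a, a.symm}) (fun b hb => ?_) (Set.toFinite _)).trans ?_
    · exact (SimpleGraph.dart_edge_eq_iff b a).1 hb
    · exact (Set.ncard_insert_le _ _).trans (by simp)

/-- A graph with vertices at distinct points `p v` of a grid of side `q` in dimension `k - 1` and
with at most `D` darts at each vertex embeds thickly into a cube of side `O(q)` in dimension `k`. -/
theorem exists_isThickEmbedding_in_cube [Finite V] (hk : 3 ≤ k) (hD : 0 < D) {q : ℕ}
    (hp : Function.Injective p) (hpq : ∀ v i, 0 ≤ p v i ∧ p v i < q)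
    (hp0 : ∀ v (i : Fin k), (i : ℕ) = 0 → p v i = 0) (hidx : ∀ a, idx a < D)
    (hinj : ∀ a b, a.fst = b.fst → idx a = idx b → a = b) :
    ∃ f : GraphRealisation G → EuclideanSpace ℝ (Fin k), IsThickEmbedding G 1 f ∧
      ∀ x i, -1 ≤ f x i ∧ f x i ≤ k * (4 * (D * q) + 2) := by
  have hfin : Finite G.Dart := Finite.of_injective _ (SimpleGraph.Dart.toProd_injective (G := G))
  have hcell := dartCell_injective (D := D) (by lia) hp hp0 hidx hinj
  have hDp : ∀ v i (r : ℤ), 0 ≤ r → r < D → 0 ≤ D * p v i + r ∧ D * p v i + r < D * q := by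
    intro v i r h0 hr
    obtain ⟨h1, h2⟩ := hpq v i
    constructor <;> nlinarith
  obtain ⟨S, hSN, hSport, hSconn, hSdisj, hSzero⟩ := exists_tracks hk
    (fun a : G.Dart => a.edge) ncard_dart_edge_eq_le_two (dartCell D p idx) (D * q)
    (fun a i => by
      have h0 := hDp a.fst i (idx a) (by lia) (by exact_mod_cast hidx a)
      simp only [dartCell]
      push_cast
      split_ifs <;> lia)
    (fun a i hi => by simp [dartCell, hi]) hcell
  let F : V → Set (Fin k → ℤ) := fun v => Set.Icc (fanRoot D p v) (fanTop D p v)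
  have hFdisj : ∀ v w, v ≠ w → Disjoint (F v) (F w) := fun v w => disjoint_fanBox (by lia) hp hp0
  have hroot : ∀ v, fanRoot D p v ∈ F v := fun v => ⟨le_rfl, fanRoot_le_fanTop hD v⟩
  let i₀ : Fin k := ⟨0, by lia⟩
  -- a box below the bottom face meets tracks in the ports of its vertex only
  have hFS : ∀ e v, v ∉ e → Disjoint (S e) (F v) := by
    refine fun e v hv => Set.disjoint_left.2 fun x hx hxv => ?_
    have h1 := (hSN e x hx i₀).1
    have h2 : x i₀ ≤ 0 := by simpa [fanTop, i₀] using hxv.2 i₀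
    obtain ⟨a, rfl, rfl⟩ := hSzero e x hx i₀ rfl (le_antisymm h2 h1)
    refine hv ?_
    by_contra hv
    have hne : a.fst ≠ v := fun h => hv (h ▸ Sym2.mem_mk_left a.fst a.snd)
    exact Set.disjoint_left.1 (hFdisj _ _ hne) (port_mem_fanBox hidx a) hxv
  have hfanS : ∀ e (a : G.Dart) t, fan D p idx a t ∈ cubicalHull (S e) →
      a.edge = e ∧ fan D p idx a t = latticePoint (port (dartCell D p idx) a) := by
    intro e a t h
    have h0 := (apply_bounds_of_mem_cubicalHull (hSN e) h i₀).1
    rw [fan_apply, if_pos rfl] at h0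
    have ht : t = 1 := by
      refine Subtype.ext (le_antisymm t.2.2 ?_)
      push_cast at h0
      change (1 : ℝ) ≤ t
      linarith
    subst ht
    rw [(fan D p idx a).target] at h ⊢
    refine ⟨?_, rfl⟩
    by_contra hne
    exact Set.disjoint_left.1 (hSdisj _ _ hne) (hSport a) (latticePoint_mem_cubicalHull.1 h)
  let K : Sym2 V → Set (EuclideanSpace ℝ (Fin k)) := fun e =>
    {x | x ∈ cubicalHull (S e) ∨ ∃ a : G.Dart, a.edge = e ∧ ∃ t, fan D p idx a t = x}
  let A : Sym2 V → Set (Fin k → ℤ) := fun e => S e ∪ {x | ∃ v, v ∈ e ∧ x ∈ F v}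
  have hKA : ∀ e, K e ⊆ cubicalHull (A e) := by
    rintro e x (hx | ⟨a, rfl, t, rfl⟩)
    · exact cubicalHull_mono Set.subset_union_left hx
    · exact cubicalHull_mono (fun z hz => Or.inr ⟨a.fst, Sym2.mem_mk_left a.fst a.snd, hz⟩)
        (fan_mem_cubicalHull hidx a t)
  have hAF : ∀ e v, v ∉ e → Disjoint (A e) (F v) := by
    refine fun e v hv => Set.disjoint_left.2 ?_
    rintro x (hx | ⟨w, hw, hx⟩) hxv
    · exact Set.disjoint_left.1 (hFS e v hv) hx hxv
    · exact Set.disjoint_left.1 (hFdisj w v (by rintro rfl; exact hv hw)) hx hxv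
  have hAA : ∀ a e', (∀ v, v ∈ a → v ∉ e') → Disjoint (A a) (A e') := by
    intro e e' h
    have hne : e ≠ e' := by
      rintro rfl
      exact h _ e.out_fst_mem e.out_fst_mem
    refine Set.disjoint_left.2 ?_
    rintro x hx (hx' | ⟨w, hw, hx'⟩)
    · rcases hx with hx | ⟨v, hv, hx⟩
      · exact Set.disjoint_left.1 (hSdisj e e' hne) hx hx'
      · exact Set.disjoint_left.1 (hFS e' v (h v hv)) hx' hx
    · exact Set.disjoint_left.1 (hAF e w fun hw' => h w hw' hw) hx hx'
  obtain ⟨f, hf, hr⟩ : ∃ f : GraphRealisation G → EuclideanSpace ℝ (Fin k),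
      IsThickEmbedding G 1 f ∧
      ∀ x, (∃ v, f x = latticePoint (fanRoot D p v)) ∨ ∃ e, f x ∈ K e := by
    refine GraphRealisation.exists_isThickEmbedding_of_sets ?_ ?_ ?_ ?_ ?_
    · intro a
      have hne : port (dartCell D p idx) a ≠ port (dartCell D p idx) a.symm := by
        intro h
        refine a.symm_ne (hcell (funext fun i => ?_)).symm
        exact mul_left_cancel₀ (show (k : ℤ) ≠ 0 by lia) (congrFun h i)
      have hsegne : ∀ b : G.Dart, Function.Injective (fan D p idx b) := by
        intro b
        refine Path.segment_injective_of_ne (latticePoint_injective.ne fun h => ?_)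
        have := congrFun h i₀
        simp [fanRoot, port, dartCell, i₀] at this
      obtain ⟨γ, hγ, hγS⟩ := exists_injective_path (hSport a) hne (hSconn a a.symm a.edge_symm.symm)
      obtain ⟨δ, hδ, hδfan⟩ :
          ∃ δ : Path (latticePoint (port (dartCell D p idx) a.symm))
            (latticePoint (fanRoot D p a.snd)),
            Function.Injective δ ∧ ∀ t, ∃ s, δ t = fan D p idx a.symm s :=
        ⟨(fan D p idx a.symm).symm,
          (hsegne a.symm).comp unitInterval.symm_bijective.injective, fun t => ⟨_, rfl⟩⟩
      refine ⟨(fan D p idx a).trans (γ.trans δ), ?_, fun t => ?_⟩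
      · refine Path.trans_injective (hsegne a) (Path.trans_injective hγ hδ ?_) ?_
        · intro s t h
          obtain ⟨r, hr⟩ := hδfan t
          have h' := h.trans hr
          rw [h']
          exact (hfanS a.edge a.symm r (h' ▸ hγS s)).2
        · intro s t h
          rw [Path.trans_apply] at h
          split_ifs at h
          · exact (hfanS a.edge a s (h ▸ hγS _)).2
          · obtain ⟨r, hr⟩ := hδfan ⟨_, _⟩
            have := (fan_eq_fan (by lia) hp hp0 hidx hinj a.symm_ne.symm (h.trans hr)).1
            exact absurd this a.fst_ne_snd
      · rw [Path.trans_apply]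
        split_ifs
        · exact Or.inr ⟨a, rfl, _, rfl⟩
        · rw [Path.trans_apply]
          split_ifs
          · exact Or.inl (hγS _)
          · obtain ⟨r, hr⟩ := hδfan ⟨_, _⟩
            exact Or.inr ⟨a.symm, a.edge_symm, r, hr.symm⟩
    · rintro e e' x hne (hx | ⟨a, rfl, t, rfl⟩) (hx' | ⟨b, rfl, s, hs⟩)
      · have := one_le_dist_of_mem_cubicalHull (hSdisj e e' hne) hx hx'
        rw [dist_self] at this
        linarith
      · exact absurd (hfanS e b s (hs ▸ hx)).1.symm hne
      · exact absurd (hfanS e' a t hx').1 hne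
      · have := fan_eq_fan (by lia) hp hp0 hidx hinj (fun h : a = b => hne (congrArg _ h)) hs.symm
        exact ⟨a.fst, Sym2.mem_mk_left a.fst a.snd, this.1 ▸ Sym2.mem_mk_left b.fst b.snd, this.2⟩
    · exact fun v w h => one_le_dist_of_mem_cubicalHull (hFdisj v w h)
        (latticePoint_mem_cubicalHull.2 (hroot v)) (latticePoint_mem_cubicalHull.2 (hroot w))
    · exact fun e v x hv hx => one_le_dist_of_mem_cubicalHull (hAF e v hv) (hKA e hx)
        (latticePoint_mem_cubicalHull.2 (hroot v))
    · exact fun e e' x y h hx hy => one_le_dist_of_mem_cubicalHull (hAA e e' h) (hKA e hx) (hKA e' hy)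
  refine ⟨f, hf, fun x i => ?_⟩
  have hF : ∀ v, ∀ z ∈ F v, ∀ i, -1 ≤ z i ∧ z i ≤ k * (4 * (D * q : ℕ) + 2) := by
    intro v z hz i
    have h1 := hz.1 i
    have h2 := hz.2 i
    obtain ⟨h3, -⟩ := hDp v i 0 le_rfl (by lia)
    obtain ⟨h5, h6⟩ := hDp v i (D - 1) (by lia) (by lia)
    have hk0 : (0 : ℤ) < k := by lia
    simp only [fanRoot, fanTop] at h1 h2
    push_cast
    split_ifs at h1 h2 <;> constructor <;> nlinarith
  have hx : f x ∈ cubicalHull {z | ∀ i, -1 ≤ z i ∧ z i ≤ (k : ℤ) * (4 * (D * q : ℕ) + 2)} := by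
    rcases hr x with ⟨v, hv⟩ | ⟨e, he⟩
    · rw [hv]
      exact latticePoint_mem_cubicalHull.2 (hF v _ (hroot v))
    · refine cubicalHull_mono ?_ (hKA e he)
      rintro z (hz | ⟨v, -, hz⟩)
      · exact fun i => ⟨by have := (hSN e z hz i).1; lia, (hSN e z hz i).2⟩
      · exact hF v z hz
  have := apply_bounds_of_mem_cubicalHull (fun z hz => hz) hx i
  push_cast at this
  exact this

end Fans

/-! ### Diameter and volume -/

section Bounds

variable {k : ℕ}

theorem mapDiam_le_of_bounds {X : Type*} {f : X → EuclideanSpace ℝ (Fin k)} {N : ℝ} (hN : 0 ≤ N)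
    (hf : ∀ x i, -1 ≤ f x i ∧ f x i ≤ N) : mapDiam f ≤ ENNReal.ofReal (k * (N + 1)) := by
  refine Metric.ediam_le ?_
  rintro _ ⟨x, rfl⟩ _ ⟨y, rfl⟩
  rw [edist_dist]
  refine ENNReal.ofReal_le_ofReal ?_
  rw [EuclideanSpace.dist_eq, Real.sqrt_le_left (by positivity)]
  calc ∑ i, dist (f x i) (f y i) ^ 2 ≤ ∑ _i : Fin k, (N + 1) ^ 2 := by
        refine Finset.sum_le_sum fun i _ => pow_le_pow_left₀ dist_nonneg ?_ 2
        rw [Real.dist_eq, abs_le]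
        have h1 := hf x i
        have h2 := hf y i
        constructor <;> linarith
    _ = k * (N + 1) ^ 2 := by simp
    _ ≤ (k : ℝ) ^ 2 * (N + 1) ^ 2 := by
        refine mul_le_mul_of_nonneg_right ?_ (by positivity)
        exact_mod_cast Nat.le_self_pow two_ne_zero k
    _ = (k * (N + 1)) ^ 2 := by ring

theorem mapVol_le_of_bounds {X : Type*} {f : X → EuclideanSpace ℝ (Fin k)} {N : ℝ} (hN : 0 ≤ N)
    (hf : ∀ x i, -1 ≤ f x i ∧ f x i ≤ N) : mapVol f ≤ ENNReal.ofReal ((N + 3) ^ k) := by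
  have hsub : Metric.thickening 1 (Set.range f) ⊆
      WithLp.ofLp ⁻¹' Set.Icc (fun _ : Fin k => (-2 : ℝ)) (fun _ => N + 1) := by
    intro y hy
    obtain ⟨_, ⟨x, rfl⟩, hxy⟩ := Metric.mem_thickening_iff.1 hy
    have h : ∀ i, -2 ≤ y i ∧ y i ≤ N + 1 := by
      intro i
      have h1 := abs_le.1 ((abs_sub_apply_le_dist y (f x) i).trans hxy.le)
      have h2 := hf x i
      constructor <;> linarith
    exact ⟨fun i => (h i).1, fun i => (h i).2⟩
  refine (MeasureTheory.measure_mono hsub).trans ?_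
  rw [(PiLp.volume_preserving_ofLp (Fin k)).measure_preimage measurableSet_Icc.nullMeasurableSet,
    Real.volume_Icc_pi, Finset.prod_const, Finset.card_univ, Fintype.card_fin,
    ← ENNReal.ofReal_pow (by linarith)]
  exact ENNReal.ofReal_le_ofReal (le_of_eq (by ring))

end Bounds

theorem exists_dart_numbering {V : Type*} [Fintype V] (G : SimpleGraph V) [DecidableRel G.Adj]
    {d : ℕ} (hd : G.maxDegree ≤ d) :
    ∃ idx : G.Dart → ℕ, (∀ a, idx a < d + 1) ∧
      ∀ a b, a.fst = b.fst → idx a = idx b → a = b := by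
  refine ⟨fun a => (G.neighborFinset a.fst).equivFin
    ⟨a.snd, (G.mem_neighborFinset _ _).2 a.adj⟩, fun a => ?_, ?_⟩
  · have h1 := ((G.neighborFinset a.fst).equivFin
      ⟨a.snd, (G.mem_neighborFinset _ _).2 a.adj⟩).2
    have h2 : (G.neighborFinset a.fst).card ≤ G.maxDegree := G.degree_le_maxDegree a.fst
    lia
  · rintro ⟨⟨u, v⟩, h⟩ ⟨⟨u', v'⟩, h'⟩ rfl hidx
    have := (G.neighborFinset u).equivFin.injective (Fin.ext hidx)
    simp only [Subtype.mk.injEq] at this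
    subst this
    rfl

theorem exists_grid_position {V : Type*} [Fintype V] {k q : ℕ} (hk : 0 < k)
    (hq : Fintype.card V ≤ q ^ (k - 1)) :
    ∃ p : V → Fin k → ℤ, Function.Injective p ∧ (∀ v (i : Fin k), (i : ℕ) = 0 → p v i = 0) ∧
      ∀ v i, 0 ≤ p v i ∧ p v i < max q 1 := by
  obtain ⟨g⟩ : Nonempty (V ↪ (Fin (k - 1) → Fin q)) :=
    Function.Embedding.nonempty_of_card_le (by simpa using hq)
  refine ⟨fun v i => if h : (i : ℕ) = 0 then 0 else g v ⟨i - 1, by lia⟩, fun v w h => ?_,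
    fun v i hi => by simp [hi], fun v i => ?_⟩
  · refine g.injective (funext fun j => Fin.ext ?_)
    have := congrFun h ⟨j + 1, by lia⟩
    simpa using this
  · dsimp only
    split_ifs with h
    · simp
    · have := (g v ⟨i - 1, by lia⟩).2
      lia

theorem theorem1p3 (d k : ℕ) (hk : 3 ≤ k) :
    ∃ C : ℝ, 0 < C ∧
      ∀ (V : Type*) [Fintype V] (G : SimpleGraph V) [DecidableRel G.Adj], G.maxDegree ≤ d →
        ∃ f : GraphRealisation G → EuclideanSpace ℝ (Fin k),
          IsThickEmbedding G 1 f ∧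
          mapDiam f ≤ ENNReal.ofReal (C * (Fintype.card V : ℝ) ^ (1 / ((k : ℝ) - 1))) ∧
          mapVol f ≤ ENNReal.ofReal (C * (Fintype.card V : ℝ) ^ (1 + 1 / ((k : ℝ) - 1))) := by
  -- the cube will have side at most `B * |V| ^ (1 / (k - 1))`
  let B : ℝ := k * (8 * (d + 1) + 2) + 3
  have hB : 3 ≤ B := le_add_of_nonneg_left (by positivity)
  refine ⟨k * B + B ^ k, by positivity, fun V _ G _ hd => ?_⟩
  have hk1 : (0 : ℝ) < (k : ℝ) - 1 := by
    have : (3 : ℝ) ≤ k := by exact_mod_cast hk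
    linarith
  set y : ℝ := (Fintype.card V : ℝ) ^ (1 / ((k : ℝ) - 1)) with hy
  have hy0 : 0 ≤ y := by positivity
  have hq : Fintype.card V ≤ ⌈y⌉₊ ^ (k - 1) := by
    have h1 : y ^ (k - 1) = Fintype.card V := by
      rw [hy, ← Real.rpow_natCast, ← Real.rpow_mul (by positivity), Nat.cast_sub (by lia),
        Nat.cast_one, one_div_mul_cancel hk1.ne', Real.rpow_one]
    have h2 : y ^ (k - 1) ≤ (⌈y⌉₊ : ℝ) ^ (k - 1) := pow_le_pow_left₀ hy0 (Nat.le_ceil y) _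
    rw [h1] at h2
    exact_mod_cast h2
  obtain ⟨p, hp, hp0, hpq⟩ := exists_grid_position (by lia) hq
  obtain ⟨idx, hidx, hinj⟩ := exists_dart_numbering G hd
  obtain ⟨f, hf, hN⟩ := exists_isThickEmbedding_in_cube (D := d + 1) (q := max ⌈y⌉₊ 1) hk
    (Nat.succ_pos d) hp (by exact_mod_cast hpq) hp0 hidx hinj
  refine ⟨f, hf, ?_⟩
  rcases isEmpty_or_nonempty V with hV | hV
  · -- the empty graph, for which `y = 0`
    have hempty : IsEmpty (GraphRealisation G) := ⟨fun x => by
      rcases GraphRealisation.vertex_or_point x with ⟨v, -⟩ | ⟨a, -, -⟩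
      · exact hV.elim v
      · exact hV.elim a.fst⟩
    simp [mapDiam, mapVol, Set.range_eq_empty]
  have hy1 : 1 ≤ y := Real.one_le_rpow (by exact_mod_cast Fintype.card_pos) (by positivity)
  set N : ℝ := k * (4 * (((d + 1 : ℕ) : ℝ) * (max ⌈y⌉₊ 1 : ℕ)) + 2) with hNdef
  have hN0 : 0 ≤ N := by positivity
  have hNB : N + 3 ≤ B * y := by
    have hq2 : ((max ⌈y⌉₊ 1 : ℕ) : ℝ) ≤ 2 * y := by
      rw [Nat.cast_max, max_le_iff]
      have := (Nat.ceil_lt_add_one hy0).le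
      push_cast
      constructor <;> linarith
    calc N + 3 ≤ k * (4 * (((d + 1 : ℕ) : ℝ) * (2 * y)) + 2 * y) + 3 * y := by
          rw [hNdef]
          gcongr <;> linarith
      _ = B * y := by
          simp only [B]
          push_cast
          ring
  constructor
  · refine (mapDiam_le_of_bounds hN0 hN).trans (ENNReal.ofReal_le_ofReal ?_)
    calc k * (N + 1) ≤ k * (B * y) := by gcongr; linarith
      _ ≤ (k * B + B ^ k) * y := by
          have : 0 ≤ B ^ k * y := by positivity
          linarith
  · refine (mapVol_le_of_bounds hN0 hN).trans (ENNReal.ofReal_le_ofReal ?_)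
    have hyk : y ^ k = (Fintype.card V : ℝ) ^ (1 + 1 / ((k : ℝ) - 1)) := by
      rw [hy, ← Real.rpow_natCast, ← Real.rpow_mul (by positivity)]
      congr 1
      field_simp
      ring
    calc (N + 3) ^ k ≤ (B * y) ^ k := by gcongr
      _ = B ^ k * y ^ k := mul_pow _ _ _
      _ ≤ (k * B + B ^ k) * y ^ k := by
          have : 0 ≤ k * B * y ^ k := by positivity
          linarith
      _ = _ := by rw [hyk]
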